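/- Let $\Omega$ be a finite-dimensional real inner product space, $N\ge 1$, and let $f_1,\dots,f_N:\Omega\to\mathbb R$ be convex (not necessarily strongly convex) and $L$-smooth for some $L>0$, i.e. differentiable with $f_j(\theta)\le f_j(\phi)+\langle\nabla f_j(\phi),\theta-\phi\rangle+\frac L2\|\theta-\phi\|^2$ for all $\theta,\phi\in\Omega$. Assume that $E=\frac1N\sum_{j=1}^N f_j$ is coercive, i.e. $E(\theta)\to\infty$ as $\|\theta\|\to\infty$. For $\alpha>0$ put $f_j^\alpha=f_j+\frac\alpha2\|\cdot\|^2$ and $E^\alpha=\frac1N\sum_j f_j^\alpha$. DualFL applied to $f_1^\alpha,\dots,f_N^\alpha$ with parameters $\rho\in(0,1)$, $\nu>0$ starts from $\theta^{(0)}=\theta_j^{(0)}=0$, $\zeta_j^{(0)}=\zeta_j^{(-1)}=0$, $t_0=1$, and in the communication round $n=0,1,2,\dots$: each client $j$ chooses some $\theta_j^{(n+1)}\in\Omega$, an approximate minimizer of $E^{n,j}(\theta)=f_j^\alpha(\theta)-\nu\langle\zeta_j^{(n)},\theta\rangle$; then $\theta^{(n+1)}=\frac1N\sum_j\theta_j^{(n+1)}$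 and $$\zeta_j^{(n+1)}=(1+\beta_n)\bigl(\zeta_j^{(n)}+\theta^{(n+1)}-\theta_j^{(n+1)}\bigr)-\beta_n\bigl(\zeta_j^{(n-1)}+\theta^{(n)}-\theta_j^{(n)}\bigr),$$ $$t_{n+1}=\tfrac12\Bigl(1-\rho t_n^2+\sqrt{(1-\rho t_n^2)^2+4t_n^2}\Bigr),\qquad \beta_n=\frac{t_n-1}{t_{n+1}}\,\frac{1-t_{n+1}\rho}{1-\rho}.$$ With $g_j=f_j^\alpha-\frac\nu2\|\cdot\|^2$, convex conjugate $g_j^*(p)=\sup_x\{\langle p,x\rangle-g_j(x)\}\in(-\infty,\infty]$, $E_{\mathrm d}^{n,j}(\xi)=g_j^*(\xi)+\frac1{2\nu}\|\xi-\nu\zeta_j^{(n)}\|^2$ and the primal-dual gap $\Gamma^{n,j}(\theta)=E^{n,j}(\theta)+E_{\mathrm d}^{n,j}\bigl(\nu(\zeta_j^{(n)}-\theta)\bigr)$, the inexactness criterion with parameter $\gamma>0$ is $$\Gamma^{n,j}(\theta_j^{(n+1)})\le\frac1N\Bigl(\frac{1-\sqrt\rho}{1+\gamma}\Bigr)^n\qquad(1\le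 j\le N,\ n\ge0).$$ Fix $\gamma>0$. For $\alpha>0$, call an *$\alpha$-run* any sequence generated in this way with $\rho=\alpha/(L+\alpha)$ and $\nu=\alpha$ that satisfies this criterion. Then: 1. For every $\alpha>0$, $E^\alpha$ has a unique minimizer $\theta^\alpha$, and there is a constant $C>0$, independent of $n$ and of the run, such that for every $\alpha$-run and every $n\ge0$ $$\|\nabla E(\theta^{(n)})\|\le C\Bigl(1-\sqrt{\tfrac{\alpha}{L+\alpha}}\Bigr)^{n/2}+\alpha\|\theta^\alpha\|.$$ 2. For every $\alpha_0>0$ there is $R_0>0$ with $\|\theta^\alpha\|\le R_0$ for all $\alpha\in(0,\alpha_0]$. For all $\alpha_0,R_0>0$ with this property there are a number $K$ (independent of $\epsilon$) and, for each $\epsilon\in(0,2R_0\alpha_0]$, an integer $M_{\mathrm{comm}}(\epsilon)\ge 0$ and a constant $c_\epsilon\le\log\frac1\epsilon+K$ such that for $\alpha=\epsilon/(2R_0)$ every $\alpha$-run satisfies $\|\nabla E(\theta^{(n)})\|\le\epsilon$ for all $n\ge M_{\mathrm{comm}}(\epsilon)$, and $$M_{\mathrm{comm}}(\epsilon)\le\Bigl(1+2\sqrt{1+\tfrac{2LR_0}{\epsilon}}\Bigr)\Bigl(\log\tfrac1\epsilon+c_\epsilon\Bigr).$$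 Moreover, $M_{\mathrm{comm}}(\epsilon)=\mathcal O\bigl(\frac1{\sqrt\epsilon}\log\frac1\epsilon\bigr)$ as $\epsilon\to0^+$. -/

import Mathlib

open Filter Topology Asymptotics

namespace DualFL

noncomputable section

variable {Ω : Type*} [NormedAddCommGroup Ω] [InnerProductSpace ℝ Ω] {N : ℕ}

/-- The Legendre-Fenchel conjugate `f* (p) = sup_x (⟨p, x⟩ - f x)`, extended-real valued. -/
def conjugate (f : Ω → ℝ) (p : Ω) : EReal :=
  ⨆ x : Ω, ((inner ℝ p x - f x : ℝ) : EReal)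

/-- `L`-smoothness: `h` is differentiable and satisfies the quadratic upper bound
`h θ ≤ h φ + ⟨∇h φ, θ - φ⟩ + (L / 2) ‖θ - φ‖²`. -/
def IsLSmooth [CompleteSpace Ω] (L : ℝ) (h : Ω → ℝ) : Prop :=
  Differentiable ℝ h ∧
    ∀ θ φ : Ω, h θ ≤ h φ + inner ℝ (gradient h φ) (θ - φ) + L / 2 * ‖θ - φ‖ ^ 2

/-- The global cost `E = (1/N) ∑ⱼ fⱼ`. -/
def cost (f : Fin N → Ω → ℝ) (θ : Ω) : ℝ :=
  (1 / (N : ℝ)) * ∑ j, f j θ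

/-- Coercivity: `h θ → +∞` as `‖θ‖ → ∞`. -/
def IsCoercive (h : Ω → ℝ) : Prop :=
  Tendsto h (Bornology.cobounded Ω) atTop

/-- The `ℓ²`-regularized local costs `fⱼ + (α/2) ‖·‖²`. -/
def reg (α : ℝ) (f : Fin N → Ω → ℝ) (j : Fin N) (θ : Ω) : ℝ :=
  f j θ + α / 2 * ‖θ‖ ^ 2

/-- The local objective `θ ↦ f θ - ν ⟨ζ, θ⟩` of a client with cost `f` and control variate `ζ`. -/
def localPrimal (f : Ω → ℝ) (ν : ℝ) (ζ θ : Ω) : ℝ :=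
  f θ - ν * inner ℝ ζ θ

/-- The dual local objective `ξ ↦ g* (ξ) + (1/(2ν)) ‖ξ - ν ζ‖²`, where `g = f - (ν/2) ‖·‖²`. -/
def localDual (f : Ω → ℝ) (ν : ℝ) (ζ ξ : Ω) : EReal :=
  conjugate (fun x => f x - ν / 2 * ‖x‖ ^ 2) ξ + ((1 / (2 * ν) * ‖ξ - ν • ζ‖ ^ 2 : ℝ) : EReal)

/-- The primal-dual gap of a local candidate `θ`. -/
def gap (f : Ω → ℝ) (ν : ℝ) (ζ θ : Ω) : EReal :=
  (localPrimal f ν ζ θ : EReal) + localDual f ν ζ (ν • (ζ - θ))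

/-- The scalar sequence `t₀ = 1`,
`tₙ₊₁ = (1 - ρ tₙ² + √((1 - ρ tₙ²)² + 4 tₙ²)) / 2`. -/
def t (ρ : ℝ) : ℕ → ℝ
  | 0 => 1
  | n + 1 => (1 - ρ * t ρ n ^ 2 + √((1 - ρ * t ρ n ^ 2) ^ 2 + 4 * t ρ n ^ 2)) / 2

/-- The overrelaxation parameters
`βₙ = ((tₙ - 1) / tₙ₊₁) ((1 - tₙ₊₁ ρ) / (1 - ρ))`. -/
def β (ρ : ℝ) (n : ℕ) : ℝ :=
  (t ρ n - 1) / t ρ (n + 1) * ((1 - t ρ (n + 1) * ρ) / (1 - ρ))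

/-- The server parameter: the average of the local parameters of round `n`. -/
def server (x : ℕ → Fin N → Ω) (n : ℕ) : Ω :=
  (1 / (N : ℝ)) • ∑ j, x n j

/-- The local control variates produced from the local parameters `x n j` of the clients:
`ζ⁽⁻¹⁾ = ζ⁽⁰⁾ = 0` and
`ζⱼ⁽ⁿ⁺¹⁾ = (1 + βₙ) (ζⱼ⁽ⁿ⁾ + θ⁽ⁿ⁺¹⁾ - xⱼ⁽ⁿ⁺¹⁾) - βₙ (ζⱼ⁽ⁿ⁻¹⁾ + θ⁽ⁿ⁾ - xⱼ⁽ⁿ⁾)`,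
where `θ⁽ⁿ⁾` is the server parameter. -/
def control (ρ : ℝ) (x : ℕ → Fin N → Ω) : ℕ → Fin N → Ω
  | 0 => fun _ => 0
  | 1 => fun j =>
      (1 + β ρ 0) • (0 + server x 1 - x 1 j) - β ρ 0 • (0 + server x 0 - x 0 j)
  | n + 2 => fun j =>
      (1 + β ρ (n + 1)) • (control ρ x (n + 1) j + server x (n + 2) - x (n + 2) j)
        - β ρ (n + 1) • (control ρ x n j + server x (n + 1) - x (n + 1) j)

/-- `x` is the sequence of local parameters of a run of DualFL, applied to the local costs `f` with
hyperparameters `ρ` and `ν`: the initial values are zero and, in every round `n`, the parameter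
`x (n + 1) j` returned by the local solver of client `j` for the local problem satisfies the
inexactness criterion `gap ≤ (1/N) ((1 - √ρ) / (1 + γ))ⁿ`. The local solvers are otherwise
arbitrary. The server parameters of the run are `server x n`. -/
structure IsRun (f : Fin N → Ω → ℝ) (ρ ν γ : ℝ) (x : ℕ → Fin N → Ω) : Prop where
  init : ∀ j, x 0 j = 0
  inexact : ∀ n j, gap (f j) ν (control ρ x n j) (x (n + 1) j) ≤
    ((1 / (N : ℝ) * ((1 - √ρ) / (1 + γ)) ^ n : ℝ) : EReal)

end

end DualFL

/-! With `ν = α` each `g_j` is `f_j` itself, and the regularized problem has the Fenchel dual of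
minimizing `∑ f_j*(ξ_j) + ‖P ξ‖² / (2α)`, where `P` projects onto the vectors with equal components.
Smoothness makes `∑ f_j*` strongly convex with modulus `1 / L`. In the variables `ξ_j = α (ζ_j -
θ_j)` DualFL is an inexact accelerated forward-backward method for this dual (`smul_control`), the
server parameter is the average of `ξ` divided by `-α` (`average_dual`), and the gap criterion makes
`θ_j` an approximate subgradient of `f_j*` at `ξ_j` (`exists_conjugate_of_gap_le`).

The energy is the dual suboptimality plus a weighted squared distance to a convex combination of the
previous iterate and the dual minimizer. `forward_backward_bound` and `extrapolation_bound` contract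
it by `1 - 1 / tₙ ≤ 1 - √ρ` up to errors that are smaller than the rate by a geometric factor `1 /
(1 + γ)`, hence harmless (`sqrt_le_of_perturbed_recursion`). The suboptimality controls the distance
of the server to `θ^α` (`norm_server_succ_sub_le`).

Since `∇E` is `L`-Lipschitz and `∇E(θ^α) = -α θ^α`, the gradient estimate follows. With `α = ε /
(2R₀)` the bias `α ‖θ^α‖` is at most `ε / 2`; the other term has a constant of order `1 / α`, so its
geometric factor must fall to order `ε²`, which gives the logarithm of `1 / ε²` in the round count
(`exists_rounds`). -/

namespace DualFL

/-! ### Convexity and smoothness inequalities -/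

section Smooth

variable {Ω : Type*} [NormedAddCommGroup Ω] [InnerProductSpace ℝ Ω] [CompleteSpace Ω]

/-- First-order characterization of convexity. -/
lemma le_of_convexOn_of_differentiable {h : Ω → ℝ} (hc : ConvexOn ℝ Set.univ h)
    (hd : Differentiable ℝ h) (x y : Ω) : h x + inner ℝ (gradient h x) (y - x) ≤ h y := by
  have hline : ConvexOn ℝ Set.univ (fun s : ℝ => h (AffineMap.lineMap x y s)) :=
    hc.comp_affineMap (AffineMap.lineMap x y)
  have hder : HasDerivAt (fun s : ℝ => h (AffineMap.lineMap x y s))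
      (inner ℝ (gradient h x) (y - x)) 0 := by
    have h1 : HasFDerivAt h (fderiv ℝ h x) (AffineMap.lineMap x y (0 : ℝ)) := by
      simpa using (hd x).hasFDerivAt
    have h2 := h1.comp_hasDerivAt (0 : ℝ) (AffineMap.hasDerivAt_lineMap (a := x) (b := y))
    rw [inner_gradient_left]
    exact h2
  have := hline.le_slope_of_hasDerivAt (Set.mem_univ 0) (Set.mem_univ 1) one_pos hder
  simp only [slope_def_field, AffineMap.lineMap_apply_one, AffineMap.lineMap_apply_zero,
    sub_zero, div_one] at this
  linarith

/-- For an `L`-smooth function `h`, any upper bound of `⟨p, ·⟩ - h` exceeds its value at `x` by at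
least `‖p - ∇h x‖² / (2 L)`. -/
lemma IsLSmooth.le_of_forall_inner_sub_le {L : ℝ} (hL : 0 < L) {h : Ω → ℝ} (hs : IsLSmooth L h)
    {p : Ω} {G : ℝ} (hG : ∀ x, inner ℝ p x - h x ≤ G) (x : Ω) :
    inner ℝ p x - h x + 1 / (2 * L) * ‖p - gradient h x‖ ^ 2 ≤ G := by
  -- This point maximizes the quadratic lower bound for `⟨p, ·⟩ - h` that smoothness at `x`
  -- provides.
  have h1 := hG (x + (1 / L) • (p - gradient h x))
  have h2 := hs.2 (x + (1 / L) • (p - gradient h x)) x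
  rw [add_sub_cancel_left, norm_smul, inner_smul_right, mul_pow, Real.norm_eq_abs, sq_abs] at h2
  rw [inner_add_right, inner_smul_right] at h1
  have h3 : inner ℝ p (p - gradient h x) - inner ℝ (gradient h x) (p - gradient h x)
      = ‖p - gradient h x‖ ^ 2 := by
    rw [← inner_sub_left, real_inner_self_eq_norm_sq]
  have h4 : 1 / (2 * L) * ‖p - gradient h x‖ ^ 2
      = 1 / L * ‖p - gradient h x‖ ^ 2 - L / 2 * ((1 / L) ^ 2 * ‖p - gradient h x‖ ^ 2) := by
    field_simp
    ring
  have h5 : 1 / L * inner ℝ p (p - gradient h x)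
      = 1 / L * inner ℝ (gradient h x) (p - gradient h x) + 1 / L * ‖p - gradient h x‖ ^ 2 := by
    rw [← h3]; ring
  linarith

/-- The gradient of a convex `L`-smooth function is `L`-Lipschitz. -/
lemma IsLSmooth.norm_gradient_sub_le {L : ℝ} (hL : 0 < L) {h : Ω → ℝ} (hs : IsLSmooth L h)
    (hc : ConvexOn ℝ Set.univ h) (x y : Ω) :
    ‖gradient h x - gradient h y‖ ≤ L * ‖x - y‖ := by
  -- Convexity bounds `⟨∇h y, ·⟩ - h` by its value at `y`, so the Bregman distance of `h` is caught
  -- between two quadratics.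
  have h1 := hs.le_of_forall_inner_sub_le hL (p := gradient h y)
    (G := inner ℝ (gradient h y) y - h y) (fun z => by
      have := le_of_convexOn_of_differentiable hc hs.1 y z
      rw [inner_sub_right] at this
      linarith) x
  have h2 := hs.2 x y
  rw [inner_sub_right] at h2
  have h3 : 1 / (2 * L) * ‖gradient h x - gradient h y‖ ^ 2 ≤ L / 2 * ‖x - y‖ ^ 2 := by
    rw [norm_sub_rev (gradient h x)]; linarith
  refine abs_le_of_sq_le_sq' ?_ (by positivity) |>.2
  have h4 := mul_le_mul_of_nonneg_left h3 (show 0 ≤ 2 * L by positivity)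
  have e1 : 2 * L * (1 / (2 * L) * ‖gradient h x - gradient h y‖ ^ 2)
      = ‖gradient h x - gradient h y‖ ^ 2 := by field_simp
  rw [e1] at h4
  linarith [h4, mul_pow L ‖x - y‖ 2]

end Smooth

/-! ### Boundedness of the regularized minimizers -/

section Cost

variable {Ω : Type*} [NormedAddCommGroup Ω] {N : ℕ}

lemma cost_reg (hN : 0 < N) (α : ℝ) (f : Fin N → Ω → ℝ) (θ : Ω) :
    cost (reg α f) θ = cost f θ + α / 2 * ‖θ‖ ^ 2 := by
  have : (N : ℝ) ≠ 0 := by positivity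
  simp only [cost, reg, Finset.sum_add_distrib, Finset.sum_const, Finset.card_univ,
    Fintype.card_fin, nsmul_eq_mul]
  field_simp

/-- The regularized minimizers stay in a bounded set. -/
lemma exists_norm_regularized_minimizer_le (hN : 0 < N) {f : Fin N → Ω → ℝ}
    (hcoer : IsCoercive (cost f)) :
    ∃ R : ℝ, 0 < R ∧ ∀ α : ℝ, 0 < α → ∀ θ, IsMinOn (cost (reg α f)) Set.univ θ → ‖θ‖ ≤ R := by
  have h1 := hcoer.eventually (eventually_gt_atTop (cost f 0))
  have h2 : Bornology.IsBounded {θ | ¬ cost f 0 < cost f θ} := by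
    rw [← Bornology.isCobounded_compl_iff]
    rw [Bornology.isCobounded_def]
    filter_upwards [h1] with θ hθ using not_not.2 hθ
  obtain ⟨R, hR, hb⟩ := h2.exists_pos_norm_le
  refine ⟨R, hR, fun α hα θ hθ => hb θ ?_⟩
  -- The regularizer vanishes at `0`, so every minimizer lies in the sublevel set of `E(0)`, which
  -- does not depend on `α`.
  have h3 : cost (reg α f) θ ≤ cost (reg α f) 0 := hθ (Set.mem_univ 0)
  rw [cost_reg hN, cost_reg hN] at h3
  have : 0 ≤ α / 2 * ‖θ‖ ^ 2 := by positivity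
  simp only [norm_zero] at h3
  simp only [Set.mem_ofPred_eq, not_lt]
  linarith

end Cost

/-! ### Existence, uniqueness and optimality condition of the regularized minimizer -/

section Minimizer

variable {Ω : Type*} [NormedAddCommGroup Ω] [InnerProductSpace ℝ Ω] {N : ℕ}

lemma convexOn_cost {f : Fin N → Ω → ℝ} (hc : ∀ j, ConvexOn ℝ Set.univ (f j)) :
    ConvexOn ℝ Set.univ (cost f) := by
  have : ConvexOn ℝ Set.univ (∑ j, f j) := by
    refine Finset.sum_induction _ (ConvexOn ℝ Set.univ) (fun _ _ => ConvexOn.add)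
      (convexOn_const 0 convex_univ) fun j _ => hc j
  have := this.smul (show 0 ≤ 1 / (N : ℝ) by positivity)
  refine this.congr fun x _ => ?_
  simp [cost]

variable [CompleteSpace Ω]

lemma gradient_cost {f : Fin N → Ω → ℝ} (hd : ∀ j, Differentiable ℝ (f j)) (x : Ω) :
    gradient (cost f) x = (1 / (N : ℝ)) • ∑ j, gradient (f j) x := by
  refine HasGradientAt.gradient ?_
  rw [hasGradientAt_iff_hasFDerivAt, map_smul, map_sum]
  simp_rw [toDual_gradient]
  exact (HasFDerivAt.fun_sum fun j _ => (hd j x).hasFDerivAt).const_mul _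

lemma isLSmooth_cost (hN : 0 < N) {L : ℝ} {f : Fin N → Ω → ℝ} (hs : ∀ j, IsLSmooth L (f j)) :
    IsLSmooth L (cost f) := by
  have hN' : (0 : ℝ) < N := by exact_mod_cast hN
  refine ⟨(Differentiable.fun_sum fun j _ => (hs j).1).const_mul _, fun θ φ => ?_⟩
  rw [gradient_cost fun j => (hs j).1, inner_smul_left, sum_inner]
  have := Finset.sum_le_sum fun j (_ : j ∈ Finset.univ) => (hs j).2 θ φ
  simp only [Finset.sum_add_distrib, Finset.sum_const, Finset.card_univ, Fintype.card_fin,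
    nsmul_eq_mul] at this
  have := mul_le_mul_of_nonneg_left this (show 0 ≤ 1 / (N : ℝ) by positivity)
  simp only [cost]
  refine this.trans_eq ?_
  simp only [conj_trivial]
  field_simp

/-- Convexity, smoothness and coercivity give the regularized minimizer, characterized by
`∇E θ = -α θ`. -/
lemma exists_regularized_minimizer [FiniteDimensional ℝ Ω] (hN : 0 < N) {f : Fin N → Ω → ℝ}
    {L : ℝ} (hs : ∀ j, IsLSmooth L (f j)) (hc : ∀ j, ConvexOn ℝ Set.univ (f j))
    (hcoer : IsCoercive (cost f)) {α : ℝ} (hα : 0 < α) :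
    ∃ θ₀ : Ω, (∀ θ, IsMinOn (cost (reg α f)) Set.univ θ ↔ θ = θ₀) ∧
      gradient (cost f) θ₀ = -(α • θ₀) := by
  have hE := isLSmooth_cost hN hs
  have hcE := convexOn_cost hc
  have hcont : Continuous (cost (reg α f)) := by
    have : cost (reg α f) = fun θ => cost f θ + α / 2 * ‖θ‖ ^ 2 := funext (cost_reg hN α f)
    rw [this]
    have := hE.1.continuous
    fun_prop
  have hlim : Tendsto (cost (reg α f)) (cocompact Ω) atTop := by
    rw [← Metric.cobounded_eq_cocompact]
    refine tendsto_atTop_mono (fun θ => ?_) hcoer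
    rw [cost_reg hN]
    have : 0 ≤ α / 2 * ‖θ‖ ^ 2 := by positivity
    linarith
  obtain ⟨θ₀, hθ₀⟩ := hcont.exists_forall_le hlim
  have hgrad : gradient (cost f) θ₀ = -(α • θ₀) := by
    have h1 : HasFDerivAt (cost (reg α f))
        (fderiv ℝ (cost f) θ₀ + (α / 2) • (2 • (innerSL ℝ θ₀))) θ₀ := by
      have : cost (reg α f) = fun θ => cost f θ + α / 2 * ‖θ‖ ^ 2 := funext (cost_reg hN α f)
      rw [this]
      exact (hE.1 θ₀).hasFDerivAt.add
        ((hasStrictFDerivAt_norm_sq θ₀).hasFDerivAt.const_mul (α / 2))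
    have h2 : IsLocalMin (cost (reg α f)) θ₀ := Filter.Eventually.of_forall hθ₀
    have h3 := h2.hasFDerivAt_eq_zero h1
    refine ext_inner_right ℝ fun v => ?_
    have h4 := congrArg (fun l => l v) h3
    simp only [add_apply, smul_apply,
      innerSL_apply_apply, zero_apply, nsmul_eq_mul, smul_eq_mul] at h4
    rw [inner_gradient_left, inner_neg_left, real_inner_smul_left]
    push_cast at h4
    linarith
  have hgrowth : ∀ θ, cost (reg α f) θ₀ + α / 2 * ‖θ - θ₀‖ ^ 2 ≤ cost (reg α f) θ := by
    intro θ
    have h1 := le_of_convexOn_of_differentiable hcE hE.1 θ₀ θ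
    rw [cost_reg hN, cost_reg hN, norm_sub_sq_real]
    rw [hgrad, inner_neg_left, real_inner_smul_left, inner_sub_right,
      real_inner_self_eq_norm_sq] at h1
    rw [real_inner_comm] at h1
    linarith
  refine ⟨θ₀, fun θ => ⟨fun h => ?_, ?_⟩, hgrad⟩
  · have h1 := hgrowth θ
    have h2 : cost (reg α f) θ ≤ cost (reg α f) θ₀ := h (Set.mem_univ θ₀)
    have h3 : ‖θ - θ₀‖ ^ 2 ≤ 0 := by
      by_contra! h4
      have : 0 < α / 2 * ‖θ - θ₀‖ ^ 2 := by positivity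
      linarith
    have h4 : ‖θ - θ₀‖ = 0 := pow_eq_zero_iff two_ne_zero |>.1 (le_antisymm h3 (by positivity))
    exact sub_eq_zero.1 (norm_eq_zero.1 h4)
  · rintro rfl
    exact fun θ _ => hθ₀ θ

end Minimizer

/-! ### From the gap criterion to a Fenchel-Young inequality -/

section Gap

variable {Ω : Type*} [NormedAddCommGroup Ω] [InnerProductSpace ℝ Ω] {N : ℕ}

/-- A bound for the gap of the regularized local problem with `ν = α` is a bound for the
Fenchel-Young gap of the unregularized cost; in particular the conjugate is finite there. -/
lemma exists_conjugate_of_gap_le {f : Fin N → Ω → ℝ} {j : Fin N} {α : ℝ} (hα : 0 < α) {ζ θ : Ω}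
    {δ : ℝ} (h : gap (reg α f j) α ζ θ ≤ (δ : EReal)) :
    ∃ G : ℝ, (∀ x, inner ℝ (α • (ζ - θ)) x - f j x ≤ G) ∧
      G + f j θ - inner ℝ (α • (ζ - θ)) θ ≤ δ := by
  have hreg : (fun x => reg α f j x - α / 2 * ‖x‖ ^ 2) = f j := by
    funext x; simp [reg]
  rw [gap, localDual, hreg] at h
  have hle : ∀ x, ((inner ℝ (α • (ζ - θ)) x - f j x : ℝ) : EReal)
      ≤ conjugate (f j) (α • (ζ - θ)) := fun x =>
    le_iSup (fun x : Ω => ((inner ℝ (α • (ζ - θ)) x - f j x : ℝ) : EReal)) x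
  have hbot : conjugate (f j) (α • (ζ - θ)) ≠ ⊥ := by
    intro hb
    have := hle 0
    rw [hb, le_bot_iff] at this
    exact EReal.coe_ne_bot _ this
  have htop : conjugate (f j) (α • (ζ - θ)) ≠ ⊤ := by
    intro ht
    rw [ht, EReal.top_add_coe, EReal.coe_add_top, top_le_iff] at h
    exact EReal.coe_ne_top _ h
  lift conjugate (f j) (α • (ζ - θ)) to ℝ using ⟨htop, hbot⟩ with G
  refine ⟨G, fun x => by exact_mod_cast hle x, ?_⟩
  have h' : localPrimal (reg α f j) α ζ θ
      + (G + 1 / (2 * α) * ‖α • (ζ - θ) - α • ζ‖ ^ 2) ≤ δ := by exact_mod_cast h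
  have e1 : α • (ζ - θ) - α • ζ = -(α • θ) := by module
  rw [e1, norm_neg, norm_smul, mul_pow, Real.norm_eq_abs, sq_abs, localPrimal, reg] at h'
  rw [real_inner_smul_left, inner_sub_left, real_inner_self_eq_norm_sq]
  have e2 : 1 / (2 * α) * (α ^ 2 * ‖θ‖ ^ 2) = α / 2 * ‖θ‖ ^ 2 := by field_simp
  linarith

end Gap

/-! ### The scalar sequence and the perturbed recursion -/

section Scalars

variable {ρ : ℝ}

/-- The defining formula is a root of `u² - (1 - ρ t²) u - t² = 0`, rearranged here into the form
that makes the energies of consecutive steps match. -/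
lemma t_succ_sq_sub (n : ℕ) :
    t ρ (n + 1) ^ 2 - t ρ (n + 1) = (1 - ρ * t ρ (n + 1)) * t ρ n ^ 2 := by
  have h : √((1 - ρ * t ρ n ^ 2) ^ 2 + 4 * t ρ n ^ 2) ^ 2
      = (1 - ρ * t ρ n ^ 2) ^ 2 + 4 * t ρ n ^ 2 := Real.sq_sqrt (by positivity)
  simp only [t]
  linear_combination h / 4

/-- The bound `ρ t² ≤ 1` propagates because the recursion then gives `ρ (u² - u) ≤ 1 - ρ u`. It
fixes the contraction factor. -/
lemma t_bounds (h0 : 0 < ρ) (h1 : ρ < 1) (n : ℕ) : 1 ≤ t ρ n ∧ ρ * t ρ n ^ 2 ≤ 1 := by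
  induction n with
  | zero => simp [t, h1.le]
  | succ n ih =>
    obtain ⟨ih1, ih2⟩ := ih
    have hsq : 0 < t ρ n ^ 2 := by positivity
    have hrec := t_succ_sq_sub (ρ := ρ) n
    have hpos : 0 < t ρ (n + 1) := by
      have : |1 - ρ * t ρ n ^ 2| < √((1 - ρ * t ρ n ^ 2) ^ 2 + 4 * t ρ n ^ 2) := by
        rw [← Real.sqrt_sq_eq_abs]
        exact Real.sqrt_lt_sqrt (by positivity) (by linarith)
      have := neg_abs_le (1 - ρ * t ρ n ^ 2)
      simp only [t]
      linarith
    set u := t ρ (n + 1)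
    have hu : 1 ≤ u := by
      by_contra! hlt
      have : 0 < 1 - ρ * u := by nlinarith
      nlinarith [mul_pos this hsq]
    refine ⟨hu, ?_⟩
    have hnn : 0 ≤ 1 - ρ * u := by
      by_contra! hlt
      nlinarith [mul_neg_of_neg_of_pos hlt hsq]
    have := mul_le_mul_of_nonneg_left ih2 hnn
    nlinarith

lemma one_le_t (h0 : 0 < ρ) (h1 : ρ < 1) (n : ℕ) : 1 ≤ t ρ n := (t_bounds h0 h1 n).1

lemma one_sub_inv_t_le (h0 : 0 < ρ) (h1 : ρ < 1) (n : ℕ) : 1 - 1 / t ρ n ≤ 1 - √ρ := by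
  obtain ⟨ht, hρ⟩ := t_bounds h0 h1 n
  have hpos : 0 < t ρ n := by linarith
  have : √ρ * t ρ n ≤ 1 := by
    refine abs_le_of_sq_le_sq' ?_ zero_le_one |>.2
    rw [mul_pow, Real.sq_sqrt h0.le]
    linarith
  have := (le_div_iff₀ hpos).2 this
  linarith

lemma β_zero : β ρ 0 = 0 := by simp [β, t]

/-- Square roots of the solutions of `U ≤ b + d + 2 √(d U)`. -/
lemma sqrt_le_of_le_add_sqrt {U b d : ℝ} (hU : 0 ≤ U) (hb : 0 ≤ b) (hd : 0 ≤ d)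
    (h : U ≤ b + d + 2 * √(d * U)) : √U ≤ √b + 3 * √d := by
  rw [Real.sqrt_mul hd] at h
  have h1 := Real.sq_sqrt hU
  have h2 := Real.sq_sqrt hb
  have h3 := Real.sq_sqrt hd
  have n1 := Real.sqrt_nonneg U
  have n2 := Real.sqrt_nonneg b
  have n3 := Real.sqrt_nonneg d
  have h4 : (√U - √d) ^ 2 ≤ (√b + 2 * √d) ^ 2 := by nlinarith [mul_nonneg n2 n3]
  have := abs_le_of_sq_le_sq' h4 (by positivity)
  linarith [this.2]

/-- A linearly convergent recursion perturbed by errors that decay faster than the rate. -/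
lemma sqrt_le_of_perturbed_recursion {r q b : ℝ} (hr : 0 < r) (hq : 0 < q)
    (hq1 : q < 1) (hb : 0 ≤ b)
    {B : ℕ → ℝ} (hB : ∀ n, 0 ≤ B n) (h0 : B 0 ≤ b + 1 + 2 * √(1 * B 0))
    (hstep : ∀ n, B (n + 1) ≤ r * B n + (r * q) ^ (n + 1)
      + 2 * √((r * q) ^ (n + 1) * B (n + 1))) (n : ℕ) :
    √(B n) ≤ √r ^ n * (√b + 3 / (1 - √q)) := by
  have hsq : 0 < √q := Real.sqrt_pos.2 hq
  have hsr : 0 < √r := Real.sqrt_pos.2 hr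
  have hsq1 : √q < 1 := by rw [Real.sqrt_lt' one_pos]; simpa using hq1
  have key : √(B n) ≤ √r ^ n * (√b + 3 * ∑ k ∈ Finset.range (n + 1), √q ^ k) := by
    induction n with
    | zero => simpa using sqrt_le_of_le_add_sqrt (hB 0) hb zero_le_one h0
    | succ n ih =>
      have h1 := sqrt_le_of_le_add_sqrt (hB (n + 1)) (mul_nonneg hr.le (hB n)) (by positivity)
        (hstep n)
      -- Relative to the rate `√r ^ (n + 1)`, the new error costs `3 √q ^ (n + 1)`, a term of a
      -- convergent geometric series.
      have e1 : √((r * q) ^ (n + 1)) = √r ^ (n + 1) * √q ^ (n + 1) := by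
        rw [Real.sqrt_eq_iff_mul_self_eq (by positivity) (by positivity), ← mul_pow, ← mul_pow,
          ← Real.sqrt_mul hr.le, Real.mul_self_sqrt (by positivity)]
      rw [Real.sqrt_mul hr.le, e1] at h1
      have h2 := mul_le_mul_of_nonneg_left ih hsr.le
      rw [Finset.sum_range_succ]
      refine h1.trans ((add_le_add_left h2 _).trans_eq ?_)
      ring
  refine key.trans ?_
  have hgeo : ∑ k ∈ Finset.range (n + 1), √q ^ k ≤ 1 / (1 - √q) := by
    rw [geom_sum_eq hsq1.ne, ← neg_div_neg_eq]
    have : 0 < 1 - √q := by linarith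
    rw [neg_sub, neg_sub]
    gcongr
    linarith [pow_pos hsq (n + 1)]
  have : 3 * ∑ k ∈ Finset.range (n + 1), √q ^ k ≤ 3 / (1 - √q) := by
    calc _ ≤ 3 * (1 / (1 - √q)) := by gcongr
      _ = _ := by ring
  gcongr

end Scalars

/-! ### One inexact accelerated forward-backward step -/

section Step

variable {H : Type*} [NormedAddCommGroup H] [InnerProductSpace ℝ H]

/-- The over-relaxation identity behind the accelerated rate: the choice of `β` makes the
extrapolated point match the contracted energy of the previous step. -/
lemma extrapolation_bound {ρ ν L t' u : ℝ} (hν : 0 < ν) (hL : 0 < L) (hρ : ρ = ν / (L + ν))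
    (ht' : 1 ≤ t') (hu : 1 ≤ u) (hρu : ρ * u ≤ 1) (hrec : u ^ 2 - u = (1 - ρ * u) * t' ^ 2)
    (p p' z : H) :
    1 / (2 * ν) * ‖(p + ((t' - 1) / u * ((1 - u * ρ) / (1 - ρ))) • (p - p'))
        - ((1 - 1 / u) • p + (1 / u) • z)‖ ^ 2
      - 1 / (2 * L) * (1 / u * (1 - 1 / u) * ‖p - z‖ ^ 2)
    ≤ (1 - 1 / u) * (1 / 2 * (1 / ν + 1 / L)
        * ‖p - ((1 - 1 / t') • p' + (1 / t') • z)‖ ^ 2) := by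
  have hu0 : 0 < u := by linarith
  have ht0 : 0 < t' := by linarith
  have hLν : 0 < L + ν := by linarith
  have hρ0 : 0 < ρ := by rw [hρ]; positivity
  have hρ1 : 1 - ρ = L / (L + ν) := by rw [hρ]; field_simp; ring
  obtain ⟨k, hk⟩ : ∃ k, k = (1 - u * ρ) / (1 - ρ) := ⟨_, rfl⟩
  rw [← hk]
  have hρ1' : 0 < 1 - ρ := by rw [hρ1]; positivity
  have hk0 : 0 ≤ k := by rw [hk]; exact div_nonneg (by linarith) hρ1'.le
  have hk1 : k ≤ 1 := by
    rw [hk, div_le_one hρ1']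
    nlinarith
  have hkν : k = 1 - ν / L * (u - 1) := by rw [hk, hρ1, hρ]; field_simp; ring
  -- With this identity the coefficients of `‖p - z‖²` and of the cross term agree on both sides;
  -- only `k (1 - k) (t' - 1)² ‖p - p'‖² ≥ 0` remains.
  have hkt : (1 - 1 / u) * (1 / ν + 1 / L) = k * (t' / u) ^ 2 / ν := by
    have h1 : 1 - 1 / u = (1 - ρ * u) * t' ^ 2 / u ^ 2 := by rw [← hrec]; field_simp
    rw [h1, hk, hρ1]; field_simp
  have e1 : (p + ((t' - 1) / u * k) • (p - p')) - ((1 - 1 / u) • p + (1 / u) • z)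
      = (1 / u) • ((p - z) + ((t' - 1) * k) • (p - p')) := by module
  have e2 : p - ((1 - 1 / t') • p' + (1 / t') • z)
      = (1 / t') • ((p - z) + (t' - 1) • (p - p')) := by
    have h : 1 / t' * (t' - 1) = 1 - 1 / t' := by field_simp
    rw [smul_add, smul_smul, h]
    module
  rw [e1, e2]
  simp only [norm_smul, mul_pow, Real.norm_eq_abs, sq_abs, norm_add_sq_real, inner_smul_right]
  have hb : 0 ≤ ‖p - p'‖ ^ 2 := by positivity
  generalize ‖p - z‖ ^ 2 = a2 at *
  generalize ‖p - p'‖ ^ 2 = b2 at *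
  generalize inner ℝ (p - z) (p - p') = ab at *
  have hr : (1 - 1 / u) * (1 / 2 * (1 / ν + 1 / L) * ((1 / t') ^ 2 *
      (a2 + 2 * ((t' - 1) * ab) + (t' - 1) ^ 2 * b2)))
      = 1 / (2 * ν * u ^ 2) * (k * (a2 + 2 * ((t' - 1) * ab) + (t' - 1) ^ 2 * b2)) := by
    calc _ = (1 - 1 / u) * (1 / ν + 1 / L) * (1 / 2 * ((1 / t') ^ 2 *
          (a2 + 2 * ((t' - 1) * ab) + (t' - 1) ^ 2 * b2))) := by ring
      _ = _ := by rw [hkt]; field_simp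
  have hl : 1 / (2 * ν) * ((1 / u) ^ 2 *
        (a2 + 2 * ((t' - 1) * k * ab) + (t' - 1) ^ 2 * k ^ 2 * b2))
      - 1 / (2 * L) * (1 / u * (1 - 1 / u) * a2)
      = 1 / (2 * ν * u ^ 2) * ((1 - ν / L * (u - 1)) * a2 + 2 * ((t' - 1) * k * ab)
        + (t' - 1) ^ 2 * k ^ 2 * b2) := by
    field_simp; ring
  rw [hr, hl, ← hkν]
  have : 0 ≤ k * (1 - k) * ((t' - 1) ^ 2 * b2) :=
    mul_nonneg (mul_nonneg hk0 (by linarith)) (by positivity)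
  refine mul_le_mul_of_nonneg_left ?_ (by positivity)
  linarith

/-- One inexact forward-backward step for `G + (1 / (2 ν)) ‖P ·‖²`, where `P` is an orthogonal
projection and `G` is `1 / L`-strongly convex. The inexactness enters through `c` and `δ`. -/
lemma forward_backward_bound {ν L : ℝ} (hν : 0 < ν) (hL : 0 < L) (P : H →ₗ[ℝ] H)
    (hP : ∀ x y, inner ℝ (P x) y = inner ℝ (P x) (P y)) (hPn : ∀ x, ‖P x‖ ≤ ‖x‖)
    {p z η x θ c : H} {s δ Gp Gz Gx : ℝ} (hs0 : 0 ≤ s) (hs1 : s ≤ 1)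
    (hx : x = η - P η - ν • θ) (hc : ‖x - c‖ ^ 2 ≤ 2 * L * δ)
    (hG : inner ℝ ((1 - s) • p + s • z - x) θ - δ
      + 1 / (2 * L) * ((1 - s) * ‖p - c‖ ^ 2 + s * ‖z - c‖ ^ 2) ≤ (1 - s) * Gp + s * Gz - Gx) :
    Gx + 1 / (2 * ν) * ‖P x‖ ^ 2 - Gz - 1 / (2 * ν) * ‖P z‖ ^ 2
      + 1 / 2 * (1 / ν + 1 / L) * ‖x - ((1 - s) • p + s • z)‖ ^ 2
    ≤ (1 - s) * (Gp + 1 / (2 * ν) * ‖P p‖ ^ 2 - Gz - 1 / (2 * ν) * ‖P z‖ ^ 2)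
      + (1 / (2 * ν) * ‖η - ((1 - s) • p + s • z)‖ ^ 2
        - 1 / (2 * L) * (s * (1 - s) * ‖p - z‖ ^ 2))
      + δ + √(2 * δ / L) * ‖x - ((1 - s) • p + s • z)‖ := by
  have hpz : ‖P ((1 - s) • p + s • z)‖ ^ 2 ≤ (1 - s) * ‖P p‖ ^ 2 + s * ‖P z‖ ^ 2 := by
    have e := norm_sub_sq_real (P p) (P z)
    have h0 : 0 ≤ s * (1 - s) * ‖P p - P z‖ ^ 2 :=
      mul_nonneg (mul_nonneg hs0 (by linarith)) (by positivity)
    rw [map_add, map_smul, map_smul, norm_add_sq_real, norm_smul, norm_smul, inner_smul_left,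
      inner_smul_right, mul_pow, mul_pow]
    simp only [Real.norm_eq_abs, sq_abs, conj_trivial]
    nlinarith
  have hsc : (1 - s) * ‖p - c‖ ^ 2 + s * ‖z - c‖ ^ 2
      = ‖(1 - s) • p + s • z - c‖ ^ 2 + s * (1 - s) * ‖p - z‖ ^ 2 := by
    have e1 : (1 - s) • p + s • z - c = (1 - s) • (p - c) + s • (z - c) := by module
    have e2 : p - z = (p - c) - (z - c) := by module
    rw [e1, e2, norm_add_sq_real, norm_sub_sq_real (p - c), norm_smul, norm_smul, inner_smul_left,
      inner_smul_right, mul_pow, mul_pow]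
    simp only [Real.norm_eq_abs, sq_abs, conj_trivial]
    ring
  rw [hsc] at hG
  set y := (1 - s) • p + s • z with hy
  -- Descent inequality at `x` combined with convexity at `y`, both linearized at the extrapolated
  -- point `η`.
  have hsm : ‖P x‖ ^ 2 ≤ ‖P y‖ ^ 2 + 2 * inner ℝ (P η) (x - y) + ‖x - η‖ ^ 2 := by
    have h1 : ‖P x - P η‖ ^ 2 ≤ ‖x - η‖ ^ 2 := by
      rw [← map_sub]; gcongr; exact hPn _
    have h2 := sq_nonneg ‖P y - P η‖
    rw [norm_sub_sq_real, real_inner_comm, ← hP] at h1 h2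
    rw [inner_sub_right]
    linarith
  have hθ : ν * inner ℝ (y - x) θ = inner ℝ (y - x) (η - x) - inner ℝ (P η) (y - x) := by
    have : ν • θ = η - x - P η := by rw [hx]; abel
    rw [← inner_smul_right, this, inner_sub_right, real_inner_comm (y - x) (P η)]
  have hthree : 2 * inner ℝ (y - x) (η - x) = ‖y - x‖ ^ 2 + ‖x - η‖ ^ 2 - ‖η - y‖ ^ 2 := by
    have e : η - y = (η - x) - (y - x) := by abel
    rw [e, norm_sub_sq_real (η - x), norm_sub_rev x η, real_inner_comm]
    ring
  -- Strong convexity is anchored at `c`; replacing `c` by `x` costs the square-root error term.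
  have hcc : ‖x - y‖ ^ 2 - 2 * (√(2 * L * δ) * ‖x - y‖) ≤ ‖y - c‖ ^ 2 := by
    have e : y - c = (x - c) - (x - y) := by abel
    have h1 : ‖x - c‖ ≤ √(2 * L * δ) := Real.le_sqrt_of_sq_le hc
    have h2 := real_inner_le_norm (x - c) (x - y)
    have h3 := mul_le_mul_of_nonneg_right h1 (norm_nonneg (x - y))
    rw [e, norm_sub_sq_real (x - c) (x - y)]
    nlinarith [sq_nonneg ‖x - c‖]
  have hroot : √(2 * δ / L) = 1 / L * √(2 * L * δ) := by
    have : 2 * δ / L = (1 / L) ^ 2 * (2 * L * δ) := by field_simp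
    rw [this, Real.sqrt_mul (by positivity), Real.sqrt_sq (by positivity)]
  have hcc' := mul_le_mul_of_nonneg_left hcc (show 0 ≤ 1 / (2 * L) by positivity)
  have eL : 1 / (2 * L) * (‖x - y‖ ^ 2 - 2 * (√(2 * L * δ) * ‖x - y‖))
      = 1 / (2 * L) * ‖x - y‖ ^ 2 - √(2 * δ / L) * ‖x - y‖ := by
    rw [hroot]; field_simp
  rw [eL] at hcc'
  have hν2 : 0 ≤ 1 / (2 * ν) := by positivity
  have hsm' := mul_le_mul_of_nonneg_left hsm hν2
  have hpz' := mul_le_mul_of_nonneg_left hpz hν2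
  have hθ' : inner ℝ (y - x) θ = 1 / (2 * ν) * (‖y - x‖ ^ 2 + ‖x - η‖ ^ 2 - ‖η - y‖ ^ 2)
      - 1 / (2 * ν) * (2 * inner ℝ (P η) (y - x)) := by
    rw [← hthree, ← mul_sub, ← mul_sub, ← hθ]; field_simp
  have hneg : inner ℝ (P η) (y - x) = -inner ℝ (P η) (x - y) := by
    rw [← inner_neg_right, neg_sub]
  rw [norm_sub_rev y x, hneg] at hθ'
  have eν : 1 / 2 * (1 / ν + 1 / L) * ‖x - y‖ ^ 2
      = 1 / (2 * ν) * ‖x - y‖ ^ 2 + 1 / (2 * L) * ‖x - y‖ ^ 2 := by field_simp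
  rw [eν]
  rw [hθ', mul_add] at hG
  linarith

end Step

/-! ### The averaging projection -/

section Consensus

variable {Ω : Type*} [NormedAddCommGroup Ω] [InnerProductSpace ℝ Ω] {N : ℕ}

/-- The average of the components, as a linear map on the `ℓ²` product. -/
noncomputable def average : PiLp 2 (fun _ : Fin N => Ω) →ₗ[ℝ] Ω where
  toFun w := (1 / (N : ℝ)) • ∑ j, w j
  map_add' v w := by simp [Finset.sum_add_distrib]
  map_smul' a w := by simp [← Finset.smul_sum, smul_comm a]

lemma average_apply (w : PiLp 2 (fun _ : Fin N => Ω)) :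
    average w = (1 / (N : ℝ)) • ∑ j, w j := rfl

/-- The orthogonal projection onto the vectors with equal components. -/
noncomputable def consensus :
    PiLp 2 (fun _ : Fin N => Ω) →ₗ[ℝ] PiLp 2 (fun _ : Fin N => Ω) where
  toFun w := WithLp.toLp 2 fun _ => average w
  map_add' v w := by ext; simp
  map_smul' a w := by ext; simp

@[simp] lemma consensus_apply (w : PiLp 2 (fun _ : Fin N => Ω)) (j : Fin N) :
    consensus w j = average w := rfl

lemma sum_eq_smul_average (hN : 0 < N) (w : PiLp 2 (fun _ : Fin N => Ω)) :
    ∑ j, w j = (N : ℝ) • average w := by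
  have : (N : ℝ) ≠ 0 := by positivity
  rw [average_apply, smul_smul, mul_one_div_cancel this, one_smul]

lemma inner_consensus (hN : 0 < N) (v w : PiLp 2 (fun _ : Fin N => Ω)) :
    inner ℝ (consensus v) w = inner ℝ (consensus v) (consensus w) := by
  simp only [PiLp.inner_apply, consensus_apply, ← inner_sum, sum_eq_smul_average hN w,
    Finset.sum_const, Finset.card_univ, Fintype.card_fin, inner_smul_right,
    ← Nat.cast_smul_eq_nsmul ℝ]

lemma norm_consensus_le (hN : 0 < N) (w : PiLp 2 (fun _ : Fin N => Ω)) :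
    ‖consensus w‖ ≤ ‖w‖ := by
  have h := real_inner_le_norm (consensus w) w
  rw [inner_consensus hN, real_inner_self_eq_norm_sq, sq] at h
  by_contra! hlt
  have := mul_lt_mul_of_pos_left hlt ((norm_nonneg w).trans_lt hlt)
  linarith

end Consensus

/-! ### DualFL as a dual method, and its convergence -/

section Dual

variable {Ω : Type*} [NormedAddCommGroup Ω] [InnerProductSpace ℝ Ω] {N : ℕ}

/-- The dual iterates `ξ⁽⁰⁾ = 0`, `ξⱼ⁽ⁿ⁺¹⁾ = α (ζⱼ⁽ⁿ⁾ - θⱼ⁽ⁿ⁺¹⁾)`. -/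
noncomputable def dual (α ρ : ℝ) (x : ℕ → Fin N → Ω) : ℕ → PiLp 2 (fun _ : Fin N => Ω)
  | 0 => 0
  | n + 1 => WithLp.toLp 2 fun j => α • (control ρ x n j - x (n + 1) j)

/-- The extrapolated dual iterates `ξ⁽ⁿ⁾ + βₙ₋₁ (ξ⁽ⁿ⁾ - ξ⁽ⁿ⁻¹⁾)`. -/
noncomputable def extrapolated (α ρ : ℝ) (x : ℕ → Fin N → Ω) (n : ℕ) :
    PiLp 2 (fun _ : Fin N => Ω) :=
  dual α ρ x n + β ρ (n - 1) • (dual α ρ x n - dual α ρ x (n - 1))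

/-- The corrections `θ - θ_j` sum to zero over the clients, so the control variates keep zero mean
and drop out of averages of dual iterates. -/
lemma sum_control (hN : 0 < N) (ρ : ℝ) {x : ℕ → Fin N → Ω} (n : ℕ) :
    ∑ j, control ρ x n j = 0 := by
  have hserver : ∀ n, (N : ℝ) • server x n = ∑ j, x n j := fun n => by
    have : (N : ℝ) ≠ 0 := by positivity
    rw [server, smul_smul, mul_one_div_cancel this, one_smul]
  induction n using Nat.twoStepInduction with
  | zero => simp [control]
  | one =>
    simp only [control, Finset.sum_sub_distrib, ← Finset.smul_sum, Finset.sum_add_distrib,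
      Finset.sum_const, Finset.card_univ, Fintype.card_fin, ← Nat.cast_smul_eq_nsmul ℝ, hserver]
    simp
  | more n h1 h2 =>
    simp only [control, Finset.sum_sub_distrib, ← Finset.smul_sum, Finset.sum_add_distrib,
      Finset.sum_const, Finset.card_univ, Fintype.card_fin, ← Nat.cast_smul_eq_nsmul ℝ, hserver,
      h1, h2]
    simp

lemma average_dual (hN : 0 < N) (α ρ : ℝ) {x : ℕ → Fin N → Ω} (h0 : ∀ j, x 0 j = 0) (n : ℕ) :
    average (dual α ρ x n) = -(α • server x n) := by
  cases n with
  | zero => simp [dual, server, h0]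
  | succ n =>
    simp only [average_apply, dual, ← Finset.smul_sum, Finset.sum_sub_distrib, sum_control hN,
      server]
    module

/-- The control variates encode a gradient step of length `α` for `‖P ·‖² / (2α)`, taken at the
extrapolated dual point. This is the link between the algorithm and the dual method. -/
lemma smul_control (hN : 0 < N) (α ρ : ℝ) {x : ℕ → Fin N → Ω} (h0 : ∀ j, x 0 j = 0) (n : ℕ)
    (j : Fin N) :
    α • control ρ x n j = extrapolated α ρ x n j - average (extrapolated α ρ x n) := by
  have key : ∀ n, α • (control ρ x n j + server x (n + 1) - x (n + 1) j)
      = dual α ρ x (n + 1) j - average (dual α ρ x (n + 1)) := fun n => by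
    rw [average_dual hN α ρ h0]
    simp only [dual]
    module
  match n with
  | 0 => simp [control, extrapolated, dual]
  | 1 =>
    have := key 0
    simp only [control] at this
    simp only [control, extrapolated, β_zero, Nat.sub_self]
    simp only [zero_smul, add_zero, sub_zero, one_smul, this]
  | n + 2 =>
    have h1 := key (n + 1)
    have h2 := key n
    have e : α • control ρ x (n + 2) j
        = (1 + β ρ (n + 1)) • α • (control ρ x (n + 1) j + server x (n + 2) - x (n + 2) j)
        - β ρ (n + 1) • α • (control ρ x n j + server x (n + 1) - x (n + 1) j) := by
      simp only [control]
      module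
    rw [e, h1, h2]
    simp only [extrapolated, Nat.add_succ_sub_one, map_add, map_smul, map_sub, PiLp.add_apply,
      PiLp.smul_apply, PiLp.sub_apply]
    module

variable [CompleteSpace Ω]

/-- The vector of the gradients of the local costs at the components of `w`. -/
noncomputable def localGradients (f : Fin N → Ω → ℝ) (w : PiLp 2 (fun _ : Fin N => Ω)) :
    PiLp 2 (fun _ : Fin N => Ω) :=
  WithLp.toLp 2 fun j => gradient (f j) (w j)

/-- This is the `1 / L`-strong convexity of `∑ f_j*` at the dual point that has `w` as a
subgradient, stated with upper bounds `G` so that infinite conjugate values never enter. -/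
lemma inner_sub_add_norm_sq_le {L : ℝ} (hL : 0 < L) {f : Fin N → Ω → ℝ}
    (hs : ∀ j, IsLSmooth L (f j)) {p : PiLp 2 (fun _ : Fin N => Ω)} {G : Fin N → ℝ}
    (hG : ∀ j y, inner ℝ (p j) y - f j y ≤ G j) (w : PiLp 2 (fun _ : Fin N => Ω)) :
    inner ℝ p w - ∑ j, f j (w j) + 1 / (2 * L) * ‖p - localGradients f w‖ ^ 2 ≤ ∑ j, G j := by
  rw [PiLp.norm_sq_eq_of_L2, PiLp.inner_apply, Finset.mul_sum, ← Finset.sum_sub_distrib,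
    ← Finset.sum_add_distrib]
  exact Finset.sum_le_sum fun j _ => (hs j).le_of_forall_inner_sub_le hL (hG j) (w j)

/-- Linear convergence of the server parameters of a run to the regularized minimizer `θ₀`. -/
lemma norm_server_succ_sub_le (hN : 0 < N) {f : Fin N → Ω → ℝ} {L : ℝ} (hL : 0 < L)
    (hs : ∀ j, IsLSmooth L (f j)) (hc : ∀ j, ConvexOn ℝ Set.univ (f j)) {α γ : ℝ} (hα : 0 < α)
    (hγ : 0 < γ) {θ₀ : Ω} (hθ₀ : gradient (cost f) θ₀ = -(α • θ₀)) {x : ℕ → Fin N → Ω}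
    (hx : IsRun (reg α f) (α / (L + α)) α γ x) (n : ℕ) :
    ‖server x (n + 1) - θ₀‖ ≤ √(2 / α) * (√(1 - √(α / (L + α))) ^ n
      * (√(1 / (2 * α) * ∑ j, ‖gradient (f j) θ₀‖ ^ 2) + 3 / (1 - √(1 / (1 + γ))))) := by
  obtain ⟨ρ, hρ⟩ : ∃ ρ, ρ = α / (L + α) := ⟨_, rfl⟩
  rw [← hρ] at hx ⊢
  have hρ0 : 0 < ρ := by rw [hρ]; positivity
  have hρ1 : ρ < 1 := by rw [hρ, div_lt_one (by positivity)]; linarith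
  have hr : 0 < 1 - √ρ := by
    have : √ρ < 1 := by rw [Real.sqrt_lt' one_pos]; simpa using hρ1
    linarith
  set q := 1 / (1 + γ) with hq
  have hq0 : 0 < q := by positivity
  have hq1 : q < 1 := by rw [hq, div_lt_one (by positivity)]; linarith
  have hδ0 : ∀ n, 0 ≤ ((1 - √ρ) * q) ^ n := fun n => by positivity
  set ξ := dual α ρ x with hξ
  set P : PiLp 2 (fun _ : Fin N => Ω) →ₗ[ℝ] PiLp 2 (fun _ : Fin N => Ω) := consensus with hP
  set w : PiLp 2 (fun _ : Fin N => Ω) := WithLp.toLp 2 fun _ => θ₀ with hw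
  set z := localGradients f w with hz
  -- Optimality condition for the dual: `z` is the dual minimizer.
  have hPz : P z = -(α • w) := by
    ext j
    have h1 : average z = gradient (cost f) θ₀ := by
      rw [gradient_cost fun j => (hs j).1]; rfl
    rw [hP, consensus_apply, h1, hθ₀]
    rfl
  choose G hG1 hG2 using fun n j => exists_conjugate_of_gap_le hα (hx.inexact n j)
  set Gz : Fin N → ℝ := fun j => inner ℝ (z j) θ₀ - f j θ₀ with hGz
  have hGz1 : ∀ j y, inner ℝ (z j) y - f j y ≤ Gz j := fun j y => by
    have := le_of_convexOn_of_differentiable (hc j) (hs j).1 θ₀ y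
    rw [inner_sub_right] at this
    simp only [hGz]
    change inner ℝ (gradient (f j) θ₀) y - f j y ≤ inner ℝ (gradient (f j) θ₀) θ₀ - f j θ₀
    linarith
  have hξle : ∀ n v, inner ℝ (ξ (n + 1)) v - ∑ j, f j (v j)
      + 1 / (2 * L) * ‖ξ (n + 1) - localGradients f v‖ ^ 2 ≤ ∑ j, G n j := fun n v =>
    inner_sub_add_norm_sq_le hL hs (hG1 n) v
  have hzle : ∀ v, inner ℝ z v - ∑ j, f j (v j)
      + 1 / (2 * L) * ‖z - localGradients f v‖ ^ 2 ≤ ∑ j, Gz j := fun v =>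
    inner_sub_add_norm_sq_le hL hs hGz1 v
  let loc : ℕ → PiLp 2 (fun _ : Fin N => Ω) := fun n => WithLp.toLp 2 (x n)
  have hgap : ∀ n, ∑ j, G n j + ∑ j, f j (loc (n + 1) j) - inner ℝ (ξ (n + 1)) (loc (n + 1))
      ≤ ((1 - √ρ) * q) ^ n := fun n => by
    have h := Finset.sum_le_sum fun j (_ : j ∈ Finset.univ) => hG2 n j
    rw [Finset.sum_sub_distrib, Finset.sum_add_distrib, Finset.sum_const, Finset.card_univ,
      Fintype.card_fin, nsmul_eq_mul] at h
    have hN' : (N : ℝ) ≠ 0 := by positivity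
    have e : (N : ℝ) * (1 / (N : ℝ) * ((1 - √ρ) / (1 + γ)) ^ n) = ((1 - √ρ) * q) ^ n := by
      rw [← mul_assoc, mul_one_div_cancel hN', one_mul, hq, mul_one_div]
    rw [e] at h
    exact h
  -- The index is shifted: `Δ n` belongs to `ξ (n + 1)`, because the conjugates may be infinite at
  -- `ξ 0 = 0`.
  set Δ : ℕ → ℝ := fun n =>
    ∑ j, G n j + 1 / (2 * α) * ‖P (ξ (n + 1))‖ ^ 2 - ∑ j, Gz j - 1 / (2 * α) * ‖P z‖ ^ 2 with hΔ
  set D : ℕ → ℝ := fun n => 1 / 2 * (1 / α + 1 / L)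
    * ‖ξ (n + 1) - ((1 - 1 / t ρ n) • ξ n + (1 / t ρ n) • z)‖ ^ 2 with hD
  have hD0 : ∀ n, 0 ≤ D n := fun n => by positivity
  have hΔle : ∀ n, 1 / (2 * α) * ‖P (ξ (n + 1)) - P z‖ ^ 2 ≤ Δ n := fun n => by
    have h1 := hξle n w
    have h2 : ∑ j, Gz j = inner ℝ z w - ∑ j, f j (w j) := by
      rw [hGz, Finset.sum_sub_distrib, PiLp.inner_apply]
    have h3 : 0 ≤ 1 / (2 * L) * ‖ξ (n + 1) - localGradients f w‖ ^ 2 := by positivity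
    have h4 : ∀ v, inner ℝ v w = -(1 / α * inner ℝ (P v) (P z)) := fun v => by
      have h : inner ℝ (P z) v = inner ℝ (P z) (P v) := inner_consensus hN z v
      rw [real_inner_comm (P z) (P v), ← h, hPz, inner_neg_left, real_inner_smul_left,
        real_inner_comm v w]
      field_simp
    rw [h4] at h1 h2
    rw [real_inner_self_eq_norm_sq] at h2
    rw [norm_sub_sq_real]
    simp only [hΔ]
    have e1 : 1 / (2 * α) * (‖P (ξ (n + 1))‖ ^ 2 - 2 * inner ℝ (P (ξ (n + 1))) (P z) + ‖P z‖ ^ 2)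
        = 1 / (2 * α) * ‖P (ξ (n + 1))‖ ^ 2 - 1 / α * inner ℝ (P (ξ (n + 1))) (P z)
          + 1 / α * ‖P z‖ ^ 2 - 1 / (2 * α) * ‖P z‖ ^ 2 := by
      field_simp; ring
    rw [e1]
    linarith
  have hΔ0 : ∀ n, 0 ≤ Δ n := fun n => le_trans (by positivity) (hΔle n)
  -- The energy itself bounds the distance in the error term, which gives the form `2 √(δ U)` of the
  -- scalar recursion.
  have herr : ∀ n, √(2 * ((1 - √ρ) * q) ^ n / L)
      * ‖ξ (n + 1) - ((1 - 1 / t ρ n) • ξ n + (1 / t ρ n) • z)‖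
      ≤ 2 * √(((1 - √ρ) * q) ^ n * (Δ n + D n)) := fun n => by
    set v := ‖ξ (n + 1) - ((1 - 1 / t ρ n) • ξ n + (1 / t ρ n) • z)‖ with hv
    have h1 : 1 / (2 * L) * v ^ 2 ≤ Δ n + D n := by
      have h2 : D n = 1 / (2 * L) * v ^ 2 + 1 / (2 * α) * v ^ 2 := by
        simp only [hD]; rw [← hv]; field_simp; ring
      have h3 : 0 ≤ 1 / (2 * α) * v ^ 2 := by positivity
      linarith [hΔ0 n]
    have h2 : √(2 * ((1 - √ρ) * q) ^ n / L) * v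
        = 2 * √(((1 - √ρ) * q) ^ n * (1 / (2 * L) * v ^ 2)) := by
      have e : ((1 - √ρ) * q) ^ n * (1 / (2 * L) * v ^ 2)
          = (v / 2) ^ 2 * (2 * ((1 - √ρ) * q) ^ n / L) := by field_simp
      have hv0 : 0 ≤ v := norm_nonneg _
      rw [e, Real.sqrt_mul (by positivity), Real.sqrt_sq (by positivity)]
      ring
    rw [h2]
    have := hδ0 n
    gcongr
  have hprox : ∀ n, ξ (n + 1) = extrapolated α ρ x n - P (extrapolated α ρ x n)
      - α • loc (n + 1) := fun n => by
    ext j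
    have := smul_control hN α ρ hx.init n j
    change α • (control ρ x n j - x (n + 1) j) = extrapolated α ρ x n j
      - average (extrapolated α ρ x n) - α • x (n + 1) j
    rw [smul_sub, this]
  have hclose : ∀ n, ‖ξ (n + 1) - localGradients f (loc (n + 1))‖ ^ 2
      ≤ 2 * L * ((1 - √ρ) * q) ^ n := fun n => by
    have h1 := hξle n (loc (n + 1))
    have h2 := hgap n
    have h3 : 1 / (2 * L) * ‖ξ (n + 1) - localGradients f (loc (n + 1))‖ ^ 2
        ≤ ((1 - √ρ) * q) ^ n := by linarith
    rwa [one_div_mul_eq_div, div_le_iff₀' (by positivity)] at h3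
  have hGstep : ∀ n s p Gp, 0 ≤ s → (1 - s) * (inner ℝ p (loc (n + 1))
        - ∑ j, f j (loc (n + 1) j)
        + 1 / (2 * L) * ‖p - localGradients f (loc (n + 1))‖ ^ 2) ≤ (1 - s) * Gp →
      inner ℝ ((1 - s) • p + s • z - ξ (n + 1)) (loc (n + 1)) - ((1 - √ρ) * q) ^ n
      + 1 / (2 * L) * ((1 - s) * ‖p - localGradients f (loc (n + 1))‖ ^ 2
        + s * ‖z - localGradients f (loc (n + 1))‖ ^ 2)
      ≤ (1 - s) * Gp + s * ∑ j, Gz j - ∑ j, G n j := by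
    intro n s p Gp hs0 hp
    have h1 := mul_le_mul_of_nonneg_left (hzle (loc (n + 1))) hs0
    have h2 := hgap n
    rw [inner_sub_left, inner_add_left, inner_smul_left, inner_smul_left]
    simp only [conj_trivial]
    linarith
  have hbase : Δ 0 + D 0 ≤ 1 / (2 * α) * ∑ j, ‖gradient (f j) θ₀‖ ^ 2 + 1
      + 2 * √(1 * (Δ 0 + D 0)) := by
    -- As `t₀ = 1`, the weight is `s = 1` and the previous iterate has no influence; its value `Gp`
    -- can be any number.
    have h := forward_backward_bound hα hL P (inner_consensus hN) (norm_consensus_le hN)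
      zero_le_one le_rfl (hprox 0) (hclose 0) (hGstep 0 1 0 0 zero_le_one (by simp))
    have he := herr 0
    have hz2 : ‖z‖ ^ 2 = ∑ j, ‖gradient (f j) θ₀‖ ^ 2 := PiLp.norm_sq_eq_of_L2 _ _
    have hext : extrapolated α ρ x 0 = 0 := by simp [extrapolated, dual]
    have ht0 : t ρ 0 = 1 := rfl
    simp only [ht0, div_one, sub_self, zero_smul, one_smul, zero_add, pow_zero, hext, zero_sub,
      norm_neg, hz2, zero_mul, mul_zero, sub_zero] at h he
    have hDe : D 0 = 1 / 2 * (1 / α + 1 / L) * ‖ξ (0 + 1) - z‖ ^ 2 := by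
      simp [hD, ht0]
    rw [hDe] at he ⊢
    simp only [hΔ] at he ⊢
    linarith
  have hstep : ∀ n, Δ (n + 1) + D (n + 1) ≤ (1 - √ρ) * (Δ n + D n)
      + ((1 - √ρ) * q) ^ (n + 1)
      + 2 * √(((1 - √ρ) * q) ^ (n + 1) * (Δ (n + 1) + D (n + 1))) := fun n => by
    have ht := t_bounds hρ0 hρ1 (n + 1)
    have htp : 0 < t ρ (n + 1) := by linarith
    have hs0 : 0 ≤ 1 / t ρ (n + 1) := by positivity
    have hs1 : 1 / t ρ (n + 1) ≤ 1 := by rw [div_le_one htp]; exact ht.1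
    have h := forward_backward_bound hα hL P (inner_consensus hN) (norm_consensus_le hN)
      hs0 hs1 (hprox (n + 1)) (hclose (n + 1))
      (hGstep (n + 1) _ (ξ (n + 1)) (∑ j, G n j) hs0
        (mul_le_mul_of_nonneg_left (hξle n _) (by linarith)))
    have hρt : ρ * t ρ (n + 1) ≤ 1 := by nlinarith
    have h2 := extrapolation_bound hα hL hρ (one_le_t hρ0 hρ1 n) ht.1 hρt
      (t_succ_sq_sub n) (ξ (n + 1)) (ξ n) z
    have hext : extrapolated α ρ x (n + 1) = ξ (n + 1)
        + ((t ρ n - 1) / t ρ (n + 1) * ((1 - t ρ (n + 1) * ρ) / (1 - ρ))) • (ξ (n + 1) - ξ n) :=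
      rfl
    rw [hext] at h
    have he := herr (n + 1)
    have hcontr := mul_le_mul_of_nonneg_right (one_sub_inv_t_le hρ0 hρ1 (n + 1))
      (add_nonneg (hΔ0 n) (hD0 n))
    simp only [hΔ, hD] at he hcontr ⊢
    linarith
  have hconv := sqrt_le_of_perturbed_recursion hr hq0 hq1
    (b := 1 / (2 * α) * ∑ j, ‖gradient (f j) θ₀‖ ^ 2) (by positivity)
    (fun n => add_nonneg (hΔ0 n) (hD0 n)) hbase hstep n
  have hdist : ‖server x (n + 1) - θ₀‖ ≤ √(2 / α) * √(Δ n + D n) := by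
    have h1 : α ^ 2 * ‖server x (n + 1) - θ₀‖ ^ 2 ≤ ‖P (ξ (n + 1)) - P z‖ ^ 2 := by
      rw [hPz, PiLp.norm_sq_eq_of_L2]
      have e : ∀ j : Fin N, (P (ξ (n + 1)) - -(α • w)) j = -(α • (server x (n + 1) - θ₀)) :=
        fun j => by
        have := average_dual hN α ρ hx.init (n + 1)
        simp only [PiLp.sub_apply, PiLp.neg_apply, PiLp.smul_apply, hP, consensus_apply, hξ,
          this, hw]
        module
      simp only [e, norm_neg, norm_smul, mul_pow, Real.norm_eq_abs, sq_abs, Finset.sum_const,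
        Finset.card_univ, Fintype.card_fin, nsmul_eq_mul]
      have hN1 : (1 : ℝ) ≤ N := by exact_mod_cast hN
      exact le_mul_of_one_le_left (by positivity) hN1
    have h2 := (hΔle n).trans (le_add_of_nonneg_right (hD0 n))
    have h3 := mul_le_mul_of_nonneg_left h1 (show 0 ≤ 1 / (2 * α) by positivity)
    rw [← Real.sqrt_mul (by positivity)]
    refine Real.le_sqrt_of_sq_le ?_
    have h4 := mul_le_mul_of_nonneg_left (h3.trans h2) (show 0 ≤ 2 / α by positivity)
    refine le_trans (le_of_eq ?_) h4
    field_simp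
  exact hdist.trans (mul_le_mul_of_nonneg_left hconv (Real.sqrt_nonneg _))

end Dual

/-! ### Counting communication rounds -/

section Rounds

lemma one_sub_sqrt_div_pos {L α : ℝ} (hL : 0 < L) (hα : 0 < α) : 0 < 1 - √(α / (L + α)) := by
  have : √(α / (L + α)) < 1 := by
    rw [Real.sqrt_lt' one_pos, one_pow, div_lt_one (by positivity)]
    linarith
  linarith

lemma error_sum_pos {γ : ℝ} (hγ : 0 < γ) : 0 < 3 / (1 - √(1 / (1 + γ))) := by
  have : √(1 / (1 + γ)) < 1 := by
    rw [Real.sqrt_lt' one_pos, one_pow, div_lt_one (by positivity)]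
    linarith
  have : 0 < 1 - √(1 / (1 + γ)) := by linarith
  positivity

/-- The number of rounds after which the linearly convergent term, with a constant of order
`1 / α` for `α = ε / (2 R)`, is at most `ε / 2`. -/
lemma exists_rounds {L R α₀ A : ℝ} (hL : 0 < L) (hR : 0 < R) (hα₀ : 0 < α₀) (hA : 0 < A) :
    ∃ (M : ℝ → ℕ) (c : ℝ → ℝ) (K : ℝ),
      (∀ ε ∈ Set.Ioc 0 (2 * R * α₀),
        (∀ n : ℕ, M ε ≤ n → A / (ε / (2 * R))
          * (1 - √(ε / (2 * R) / (L + ε / (2 * R)))) ^ ((n : ℝ) / 2) ≤ ε / 2) ∧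
        (M ε : ℝ) ≤ (1 + 2 * √(1 + 2 * L * R / ε)) * (Real.log (1 / ε) + c ε) ∧
        c ε ≤ Real.log (1 / ε) + K) ∧
      (fun ε : ℝ => (M ε : ℝ)) =O[𝓝[>] 0] (fun ε : ℝ => 1 / √ε * Real.log (1 / ε)) := by
  -- The first summand yields `exp (-ℓ ε) ≤ ε² / (4AR)`; the second forces `ℓ ε ≥ 1`, so that
  -- rounding up fits into the summand `1` of the factor `1 + 2√(...)`.
  obtain ⟨K, hK⟩ : ∃ K : ℝ, Real.exp K = 4 * A * R + Real.exp 1 * (2 * R * α₀) ^ 2 :=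
    ⟨_, Real.exp_log (by positivity)⟩
  set ℓ : ℝ → ℝ := fun ε => Real.log (1 / ε) + (Real.log (1 / ε) + K) with hℓ
  have hexp : ∀ ε, 0 < ε → Real.exp (ℓ ε)
      = (4 * A * R + Real.exp 1 * (2 * R * α₀) ^ 2) / ε ^ 2 := fun ε hε => by
    simp only [hℓ]
    rw [Real.exp_add, Real.exp_add, hK, Real.exp_log (by positivity)]
    field_simp
  have hℓ1 : ∀ ε ∈ Set.Ioc 0 (2 * R * α₀), 1 ≤ ℓ ε := fun ε hε => by
    obtain ⟨hε0, hε1⟩ := hε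
    rw [← Real.exp_le_exp, hexp ε hε0, le_div_iff₀ (by positivity)]
    have : Real.exp 1 * ε ^ 2 ≤ Real.exp 1 * (2 * R * α₀) ^ 2 := by gcongr
    have : 0 < 4 * A * R := by positivity
    linarith
  set M : ℝ → ℕ := fun ε => ⌈2 * √(1 + 2 * L * R / ε) * ℓ ε⌉₊ with hM
  have hMle : ∀ ε ∈ Set.Ioc 0 (2 * R * α₀),
      (M ε : ℝ) ≤ (1 + 2 * √(1 + 2 * L * R / ε)) * ℓ ε := fun ε hε => by
    have h1 := hℓ1 ε hε
    have h2 := Nat.ceil_lt_add_one (show 0 ≤ 2 * √(1 + 2 * L * R / ε) * ℓ ε by positivity)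
    have h3 : (M ε : ℝ) < 2 * √(1 + 2 * L * R / ε) * ℓ ε + 1 := h2
    linarith
  refine ⟨M, fun ε => Real.log (1 / ε) + K, K, fun ε hε => ⟨fun n hn => ?_, hMle ε hε, le_rfl⟩, ?_⟩
  · have hε0 : 0 < ε := hε.1
    set σ := √(1 + 2 * L * R / ε) with hσ
    have hσ0 : 0 < σ := Real.sqrt_pos.2 (by positivity)
    have hρ : √(ε / (2 * R) / (L + ε / (2 * R))) = 1 / σ := by
      rw [hσ, one_div, ← Real.sqrt_inv]
      congr 1
      field_simp
      ring
    rw [hρ]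
    have hσ1 : 1 / σ ≤ 1 := by
      rw [div_le_one hσ0, hσ, Real.one_le_sqrt]
      have : 0 < 2 * L * R / ε := by positivity
      linarith
    have hn' : 2 * σ * ℓ ε ≤ n := (Nat.le_ceil _).trans (by exact_mod_cast hn)
    have hpow : (1 - 1 / σ) ^ ((n : ℝ) / 2) ≤ Real.exp (-ℓ ε) := by
      calc (1 - 1 / σ) ^ ((n : ℝ) / 2) ≤ Real.exp (-(1 / σ)) ^ ((n : ℝ) / 2) := by
            refine Real.rpow_le_rpow (by linarith) (Real.one_sub_le_exp_neg _) (by positivity)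
        _ = Real.exp (-(1 / σ) * ((n : ℝ) / 2)) := (Real.exp_mul _ _).symm
        _ ≤ Real.exp (-ℓ ε) := by
            rw [Real.exp_le_exp, neg_mul, neg_le_neg_iff, div_mul_div_comm, one_mul,
              le_div_iff₀ (by positivity)]
            linarith
    have hbound : Real.exp (-ℓ ε) ≤ ε ^ 2 / (4 * A * R) := by
      rw [Real.exp_neg, hexp ε hε0, inv_div]
      have : 0 < Real.exp 1 * (2 * R * α₀) ^ 2 := by positivity
      gcongr
      linarith
    calc _ ≤ A / (ε / (2 * R)) * (ε ^ 2 / (4 * A * R)) := by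
          gcongr
          exact hpow.trans hbound
      _ = ε / 2 := by field_simp; ring
  · refine IsBigO.of_bound ((1 + 2 * √(1 + 2 * L * R)) * 3) ?_
    have hlog : Tendsto (fun ε : ℝ => -Real.log ε) (𝓝[>] 0) atTop :=
      tendsto_neg_atBot_atTop.comp Real.tendsto_log_nhdsGT_zero
    filter_upwards [hlog.eventually_ge_atTop (max K 0),
      Ioc_mem_nhdsGT (show (0 : ℝ) < min (2 * R * α₀) 1 by positivity)] with ε hK hε
    obtain ⟨hε0, hε1⟩ := hε
    have hlogK : K ≤ Real.log (1 / ε) := by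
      rw [one_div, Real.log_inv]; exact (le_max_left _ _).trans hK
    have hlog0 : 0 ≤ Real.log (1 / ε) := by
      rw [one_div, Real.log_inv]; exact (le_max_right _ _).trans hK
    have hε2 : ε ≤ 1 := hε1.trans (min_le_right _ _)
    have hsε : 0 < √ε := Real.sqrt_pos.2 hε0
    have hs1 : 1 ≤ 1 / √ε := by
      rw [le_div_iff₀ hsε, one_mul, Real.sqrt_le_one]; exact hε2
    have hs2 : √(1 + 2 * L * R / ε) ≤ √(1 + 2 * L * R) * (1 / √ε) := by
      rw [mul_one_div, ← Real.sqrt_div (by positivity)]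
      apply Real.sqrt_le_sqrt
      rw [add_div]
      gcongr
      rwa [le_div_iff₀ hε0, one_mul]
    rw [Real.norm_of_nonneg (Nat.cast_nonneg _), Real.norm_of_nonneg (by positivity)]
    calc (M ε : ℝ) ≤ (1 + 2 * √(1 + 2 * L * R / ε)) * ℓ ε :=
          hMle ε ⟨hε0, hε1.trans (min_le_left _ _)⟩
      _ ≤ (1 / √ε + 2 * (√(1 + 2 * L * R) * (1 / √ε))) * (3 * Real.log (1 / ε)) := by
          have : ℓ ε ≤ 3 * Real.log (1 / ε) := by simp only [hℓ]; linarith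
          have : 0 ≤ ℓ ε := zero_le_one.trans (hℓ1 ε ⟨hε0, hε1.trans (min_le_left _ _)⟩)
          gcongr
      _ = _ := by ring

end Rounds

/-! ### The gradient estimate -/

section Gradient

variable {Ω : Type*} [NormedAddCommGroup Ω] [InnerProductSpace ℝ Ω] [CompleteSpace Ω] {N : ℕ}

/-- The gradient estimate with a constant that is explicit in `α`. -/
lemma norm_gradient_server_le (hN : 0 < N) {f : Fin N → Ω → ℝ} {L : ℝ} (hL : 0 < L)
    (hs : ∀ j, IsLSmooth L (f j)) (hc : ∀ j, ConvexOn ℝ Set.univ (f j)) {α γ : ℝ} (hα : 0 < α)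
    (hγ : 0 < γ) {θ₀ : Ω} (hθ₀ : gradient (cost f) θ₀ = -(α • θ₀)) {X R r₀ : ℝ}
    (hX : ∑ j, ‖gradient (f j) θ₀‖ ^ 2 ≤ X) (hR : ‖θ₀‖ ≤ R) (hr₀ : 0 < r₀)
    (hr : r₀ ≤ 1 - √(α / (L + α))) {x : ℕ → Fin N → Ω}
    (hx : IsRun (reg α f) (α / (L + α)) α γ x) (n : ℕ) :
    ‖gradient (cost f) (server x n)‖ ≤
      (L / √r₀ * (√(2 / α) * (√(1 / (2 * α) * X) + 3 / (1 - √(1 / (1 + γ))))) + L * R)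
        * (1 - √(α / (L + α))) ^ ((n : ℝ) / 2) + α * ‖θ₀‖ := by
  have hS := error_sum_pos hγ
  have hR0 : 0 ≤ R := (norm_nonneg _).trans hR
  have hgrad := (isLSmooth_cost hN hs).norm_gradient_sub_le hL (convexOn_cost hc) (server x n) θ₀
  have htri : ‖gradient (cost f) (server x n)‖ ≤ L * ‖server x n - θ₀‖ + α * ‖θ₀‖ := by
    have h := norm_add_le (gradient (cost f) (server x n) - gradient (cost f) θ₀)
      (gradient (cost f) θ₀)
    rw [sub_add_cancel] at h
    have h2 : ‖gradient (cost f) θ₀‖ = α * ‖θ₀‖ := by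
      rw [hθ₀, norm_neg, norm_smul, Real.norm_of_nonneg hα.le]
    linarith
  refine htri.trans (add_le_add_left ?_ _)
  -- Round `0` precedes the energy argument and is covered by the summand `L * R`; later rounds lose
  -- one factor `√r` to the index shift, whence `1 / √r₀`.
  cases n with
  | zero =>
    have h0 : server x 0 = 0 := by simp [server, hx.init]
    rw [h0, zero_sub, norm_neg, Nat.cast_zero, zero_div, Real.rpow_zero, mul_one]
    have : 0 ≤ L / √r₀ * (√(2 / α) * (√(1 / (2 * α) * X) + 3 / (1 - √(1 / (1 + γ))))) := by
      positivity
    linarith [mul_le_mul_of_nonneg_left hR hL.le]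
  | succ n =>
    have h := norm_server_succ_sub_le hN hL hs hc hα hγ hθ₀ hx n
    have hrpos := one_sub_sqrt_div_pos hL hα
    generalize 1 - √(α / (L + α)) = r at *
    generalize 3 / (1 - √(1 / (1 + γ))) = S at *
    have hpow : r ^ (((n + 1 : ℕ) : ℝ) / 2) = √r ^ (n + 1) := by
      rw [Real.sqrt_eq_rpow, ← Real.rpow_natCast, ← Real.rpow_mul hrpos.le]
      congr 1
      ring
    rw [hpow]
    have hsr : 0 < √r := Real.sqrt_pos.2 hrpos
    have hsr0 : 0 < √r₀ := Real.sqrt_pos.2 hr₀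
    calc L * ‖server x (n + 1) - θ₀‖
        ≤ L * (√(2 / α) * (√r ^ n * (√(1 / (2 * α) * X) + S))) := by
          refine mul_le_mul_of_nonneg_left (h.trans ?_) hL.le
          gcongr
      _ = L / √r * (√(2 / α) * (√(1 / (2 * α) * X) + S)) * √r ^ (n + 1) := by
          rw [pow_succ]; field_simp
      _ ≤ (L / √r₀ * (√(2 / α) * (√(1 / (2 * α) * X) + S)) + L * R) * √r ^ (n + 1) := by
          gcongr
          refine le_add_of_le_of_nonneg ?_ (by positivity)
          gcongr

end Gradient

end DualFL

/-! ### Assembly, with constants uniform in `α ≤ α₀` -/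

theorem theorem4p2 {Ω : Type*} [NormedAddCommGroup Ω] [InnerProductSpace ℝ Ω]
    [FiniteDimensional ℝ Ω] [CompleteSpace Ω]
    (N : ℕ) (hN : 0 < N) (f : Fin N → Ω → ℝ) (L : ℝ) (hL : 0 < L)
    (hconv : ∀ j, ConvexOn ℝ Set.univ (f j))
    (hsmooth : ∀ j, DualFL.IsLSmooth L (f j))
    (hcoer : DualFL.IsCoercive (DualFL.cost f))
    (γ : ℝ) (hγ : 0 < γ) :
    ∃ θreg : ℝ → Ω,
      -- `θreg α` is the unique minimizer of the regularized cost
      (∀ α : ℝ, 0 < α → ∀ θ : Ω,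
        IsMinOn (DualFL.cost (DualFL.reg α f)) Set.univ θ ↔ θ = θreg α) ∧
      -- the gradient estimate
      (∀ α : ℝ, 0 < α → ∃ C : ℝ, 0 < C ∧
        ∀ x : ℕ → Fin N → Ω, DualFL.IsRun (DualFL.reg α f) (α / (L + α)) α γ x →
          ∀ n : ℕ, ‖gradient (DualFL.cost f) (DualFL.server x n)‖ ≤
            C * (1 - √(α / (L + α))) ^ ((n : ℝ) / 2) + α * ‖θreg α‖) ∧
      -- the number of communication rounds
      (∀ α₀ : ℝ, 0 < α₀ →
        (∃ R₀ : ℝ, 0 < R₀ ∧ ∀ α ∈ Set.Ioc 0 α₀, ‖θreg α‖ ≤ R₀) ∧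
        ∀ R₀ : ℝ, 0 < R₀ → (∀ α ∈ Set.Ioc 0 α₀, ‖θreg α‖ ≤ R₀) →
          ∃ (M : ℝ → ℕ) (c : ℝ → ℝ) (K : ℝ),
            (∀ ε ∈ Set.Ioc 0 (2 * R₀ * α₀),
              (∀ x : ℕ → Fin N → Ω,
                DualFL.IsRun (DualFL.reg (ε / (2 * R₀)) f)
                  (ε / (2 * R₀) / (L + ε / (2 * R₀))) (ε / (2 * R₀)) γ x →
                ∀ n : ℕ, M ε ≤ n → ‖gradient (DualFL.cost f) (DualFL.server x n)‖ ≤ ε) ∧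
              (M ε : ℝ) ≤ (1 + 2 * √(1 + 2 * L * R₀ / ε)) * (Real.log (1 / ε) + c ε) ∧
              c ε ≤ Real.log (1 / ε) + K) ∧
            (fun ε : ℝ => (M ε : ℝ)) =O[𝓝[>] 0] (fun ε : ℝ => 1 / √ε * Real.log (1 / ε))) := by
  have hex : ∀ α : ℝ, ∃ θ₀ : Ω, 0 < α →
      (∀ θ, IsMinOn (DualFL.cost (DualFL.reg α f)) Set.univ θ ↔ θ = θ₀) ∧
        gradient (DualFL.cost f) θ₀ = -(α • θ₀) := fun α => by
    by_cases hα : 0 < α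
    · obtain ⟨θ₀, h⟩ := DualFL.exists_regularized_minimizer hN hsmooth hconv hcoer hα
      exact ⟨θ₀, fun _ => h⟩
    · exact ⟨0, fun h => absurd h hα⟩
  choose θreg hθ using hex
  refine ⟨θreg, fun α hα => (hθ α hα).1, fun α hα => ?_, fun α₀ hα₀ => ⟨?_, fun R₀ hR₀ hb => ?_⟩⟩
  · obtain ⟨C, hC⟩ : ∃ C : ℝ, ∀ x : ℕ → Fin N → Ω,
        DualFL.IsRun (DualFL.reg α f) (α / (L + α)) α γ x →
          ∀ n : ℕ, ‖gradient (DualFL.cost f) (DualFL.server x n)‖ ≤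
            C * (1 - √(α / (L + α))) ^ ((n : ℝ) / 2) + α * ‖θreg α‖ :=
      ⟨_, fun x hx n => DualFL.norm_gradient_server_le hN hL hsmooth hconv hα hγ (hθ α hα).2 le_rfl
        le_rfl (DualFL.one_sub_sqrt_div_pos hL hα) le_rfl hx n⟩
    refine ⟨max C 1, lt_of_lt_of_le one_pos (le_max_right _ _), fun x hx n => (hC x hx n).trans ?_⟩
    have := Real.rpow_nonneg (DualFL.one_sub_sqrt_div_pos hL hα).le ((n : ℝ) / 2)
    gcongr
    exact le_max_left _ _
  · obtain ⟨R, hR, h⟩ := DualFL.exists_norm_regularized_minimizer_le hN hcoer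
    exact ⟨R, hR, fun α hα => h α hα.1 _ (((hθ α hα.1).1 _).2 rfl)⟩
  · have hS := DualFL.error_sum_pos hγ
    obtain ⟨S, hSdef⟩ : ∃ S, S = 3 / (1 - √(1 / (1 + γ))) := ⟨_, rfl⟩
    rw [← hSdef] at hS
    have hr₀ := DualFL.one_sub_sqrt_div_pos hL hα₀
    -- The ratio `α / (L + α)` increases with `α`, so this is a lower bound for `1 - √ρ` on all of
    -- `(0, α₀]`.
    set r₀ := 1 - √(α₀ / (L + α₀)) with hr₀def
    have hsr₀ : 0 < √r₀ := Real.sqrt_pos.2 hr₀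
    -- Lipschitz gradients and `‖θ^α‖ ≤ R₀` bound the local gradients at `θ^α` independently of `α`.
    set X := ∑ j, (‖gradient (f j) 0‖ + L * R₀) ^ 2 with hX
    obtain ⟨M, c, K, hM, hO⟩ := DualFL.exists_rounds
      (A := L / √r₀ * (√X + √(2 * α₀) * S) + L * R₀ * α₀) hL hR₀ hα₀ (by positivity)
    refine ⟨M, c, K, fun ε hε => ⟨fun x hx n hn => ?_, (hM ε hε).2⟩, hO⟩
    have hrate := (hM ε hε).1 n hn
    obtain ⟨α, hαdef⟩ : ∃ α, α = ε / (2 * R₀) := ⟨_, rfl⟩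
    rw [← hαdef] at hx hrate
    have hε0 := hε.1
    have hα : 0 < α := by rw [hαdef]; positivity
    have hαle : α ≤ α₀ := by
      rw [hαdef, div_le_iff₀ (by positivity)]
      linarith [hε.2]
    have hθR : ‖θreg α‖ ≤ R₀ := hb α ⟨hα, hαle⟩
    have hXle : ∑ j, ‖gradient (f j) (θreg α)‖ ^ 2 ≤ X := by
      refine Finset.sum_le_sum fun j _ => ?_
      have h1 := (hsmooth j).norm_gradient_sub_le hL (hconv j) (θreg α) 0
      have h2 := norm_le_insert' (gradient (f j) (θreg α)) (gradient (f j) 0)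
      rw [sub_zero] at h1
      have h3 := mul_le_mul_of_nonneg_left hθR hL.le
      gcongr
      linarith
    have hr : r₀ ≤ 1 - √(α / (L + α)) := by
      have : α / (L + α) ≤ α₀ / (L + α₀) := by
        rw [div_le_div_iff₀ (by positivity) (by positivity)]
        nlinarith
      have := Real.sqrt_le_sqrt this
      linarith
    have hmain := DualFL.norm_gradient_server_le hN hL hsmooth hconv hα hγ (hθ α hα).2 hXle hθR
      hr₀ hr hx n
    rw [← hSdef] at hmain
    have hconst : L / √r₀ * (√(2 / α) * (√(1 / (2 * α) * X) + S)) + L * R₀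
        ≤ (L / √r₀ * (√X + √(2 * α₀) * S) + L * R₀ * α₀) / α := by
      have h1 : √(2 / α) * √(1 / (2 * α) * X) = √X / α := by
        rw [← Real.sqrt_mul (by positivity)]
        have : 2 / α * (1 / (2 * α) * X) = X / α ^ 2 := by field_simp
        rw [this, Real.sqrt_div' _ (by positivity), Real.sqrt_sq hα.le]
      have h2 : √(2 / α) ≤ √(2 * α₀) / α := by
        have : √(2 * α₀) / α = √(2 * α₀ / α ^ 2) := by
          rw [Real.sqrt_div' _ (by positivity), Real.sqrt_sq hα.le]
        rw [this]
        apply Real.sqrt_le_sqrt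
        rw [div_le_div_iff₀ hα (by positivity)]
        nlinarith
      have h3 : L * R₀ ≤ L * R₀ * α₀ / α := by
        rw [le_div_iff₀ hα]
        gcongr
      rw [mul_add, h1, add_div]
      refine add_le_add ?_ h3
      rw [mul_div_assoc]
      gcongr
      calc √X / α + √(2 / α) * S ≤ √X / α + √(2 * α₀) / α * S := by gcongr
        _ = _ := by ring
    have hpow : 0 ≤ (1 - √(α / (L + α))) ^ ((n : ℝ) / 2) :=
      Real.rpow_nonneg (DualFL.one_sub_sqrt_div_pos hL hα).le _
    have h4 := mul_le_mul_of_nonneg_right hconst hpow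
    have h5 : α * ‖θreg α‖ ≤ ε / 2 := by
      calc α * ‖θreg α‖ ≤ α * R₀ := by gcongr
        _ = ε / 2 := by rw [hαdef]; field_simp
    linarith
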